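/- Let $n\ge 1$. For $s\in\mathbb R$ and $0<q,r\le\infty$, the homogeneous Herz space $\dot K^{s}_{q,r}(\mathbb R^n)$ is the space of all (real- or complex-valued) measurable functions $f$ on $\mathbb R^n$, modulo equality almost everywhere, for which the quasi-norm $$\|f\|_{\dot K^s_{q,r}}=\Big(\sum_{j\in\mathbb Z}\big[2^{js}\|f\chi_{A_j}\|_{L^q}\big]^r\Big)^{1/r}\ (r<\infty),\qquad \|f\|_{\dot K^s_{q,\infty}}=\sup_{j\in\mathbb Z}2^{js}\|f\chi_{A_j}\|_{L^q},$$ is finite, where $A_j=\{x\in\mathbb R^n: 2^{j-1}\le|x|<2^j\}$. For two quasi-normed spaces $X_0,X_1$ of measurable functions, $0<\theta<1$ and $0<r\le\infty$, put $$K(t,f)=\inf\{\|f_0\|_{X_0}+t\|f_1\|_{X_1}: f=f_0+f_1,\ f_0\in X_0,\ f_1\in X_1\}\quad(t>0),$$ with $K(t,f)=\infty$ if $f\notin X_0+X_1$, and let $(X_0,X_1)_{\theta,r}$ be the space of all measurable $f$ with $$\|f\|_{(X_0,X_1)_{\theta,r}}=\Big(\int_0^\infty[t^{-\theta}K(t,f)]^r\,\frac{dt}{t}\Big)^{1/r}<\infty\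 (r<\infty),\qquad \|f\|_{(X_0,X_1)_{\theta,\infty}}=\sup_{t>0}t^{-\theta}K(t,f)<\infty .$$ **Theorem.** Let $0<\theta<1$, $s,s_0,s_1\in\mathbb R$ and $0<q,r,r_0,r_1\le\infty$. If $s_0\ne s_1$ and $s=(1-\theta)s_0+\theta s_1$, then $$\big(\dot K^{s_0}_{q,r_0}(\mathbb R^n),\dot K^{s_1}_{q,r_1}(\mathbb R^n)\big)_{\theta,r}=\dot K^{s}_{q,r}(\mathbb R^n)$$ as sets, with equivalent quasi-norms: there are constants $c,C\in(0,\infty)$ such that for every $f\in\dot K^{s}_{q,r}(\mathbb R^n)$, $$c\,\|f\|_{\dot K^{s}_{q,r}}\le\|f\|_{(\dot K^{s_0}_{q,r_0},\dot K^{s_1}_{q,r_1})_{\theta,r}}\le C\,\|f\|_{\dot K^{s}_{q,r}}.$$ -/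

import Mathlib

open scoped ENNReal NNReal
open MeasureTheory

noncomputable section

/-- The dyadic annulus `A_j = {x ∈ ℝⁿ : 2^(j-1) ≤ |x| < 2^j}`, `j ∈ ℤ`, for the Euclidean norm. -/
def dyadicAnnulus (n : ℕ) (j : ℤ) : Set (EuclideanSpace ℝ (Fin n)) :=
  {x | (2 : ℝ) ^ (j - 1) ≤ ‖x‖ ∧ ‖x‖ < (2 : ℝ) ^ j}

/-- Measurable `𝕜`-valued functions on `ℝⁿ`, identified when they agree Lebesgue-almost everywhere. -/
abbrev MeasFun (n : ℕ) (𝕜 : Type*) [RCLike 𝕜] : Type _ :=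
  EuclideanSpace ℝ (Fin n) →ₘ[volume] 𝕜

/-- The homogeneous Herz quasi-norm `‖f‖` of `K̇^s_{q,r}(ℝⁿ)`, with the value `∞` when `f` does not
belong to the space. -/
def herzNorm {n : ℕ} {𝕜 : Type*} [RCLike 𝕜] (s : ℝ) (q r : ℝ≥0∞) (f : MeasFun n 𝕜) : ℝ≥0∞ :=
  if r = ∞ then
    ⨆ j : ℤ, (2 : ℝ≥0∞) ^ ((j : ℝ) * s) * eLpNorm ((dyadicAnnulus n j).indicator f) q volume
  else
    (∑' j : ℤ, ((2 : ℝ≥0∞) ^ ((j : ℝ) * s) *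
      eLpNorm ((dyadicAnnulus n j).indicator f) q volume) ^ r.toReal) ^ (1 / r.toReal)

/-- The homogeneous Herz space `K̇^s_{q,r}(ℝⁿ)`. -/
def herzSpace (n : ℕ) (𝕜 : Type*) [RCLike 𝕜] (s : ℝ) (q r : ℝ≥0∞) : Set (MeasFun n 𝕜) :=
  {f | herzNorm s q r f < ∞}

/-- The `K`-functional of the couple `(X₀, X₁)` where `X_i = {f : N_i f < ∞}`:
the infimum of `N₀ f₀ + t N₁ f₁` over `f = f₀ + f₁` with `f₀ ∈ X₀`, `f₁ ∈ X₁`.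
It is `∞` (an empty infimum) exactly when `f ∉ X₀ + X₁`. -/
def kFunctional {G : Type*} [AddCommGroup G] (N₀ N₁ : G → ℝ≥0∞) (t : ℝ) (f : G) : ℝ≥0∞ :=
  ⨅ (f₀ : G) (f₁ : G) (_ : f = f₀ + f₁) (_ : N₀ f₀ < ∞) (_ : N₁ f₁ < ∞),
    (N₀ f₀ + ENNReal.ofReal t * N₁ f₁)

/-- The quasi-norm of the real interpolation space `(X₀, X₁)_{θ,r}`, `X_i = {f : N_i f < ∞}`,
with the value `∞` when `f` does not belong to the space. -/
def realInterpNorm {G : Type*} [AddCommGroup G] (N₀ N₁ : G → ℝ≥0∞) (θ : ℝ) (r : ℝ≥0∞)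
    (f : G) : ℝ≥0∞ :=
  if r = ∞ then
    ⨆ (t : ℝ) (_ : 0 < t), ENNReal.ofReal t ^ (-θ) * kFunctional N₀ N₁ t f
  else
    (∫⁻ t in Set.Ioi (0 : ℝ),
      (ENNReal.ofReal t ^ (-θ) * kFunctional N₀ N₁ t f) ^ r.toReal / ENNReal.ofReal t)
        ^ (1 / r.toReal)

/-- The real interpolation space `(X₀, X₁)_{θ,r}`, `X_i = {f : N_i f < ∞}`. -/
def realInterpSpace {G : Type*} [AddCommGroup G] (N₀ N₁ : G → ℝ≥0∞) (θ : ℝ) (r : ℝ≥0∞) : Set G :=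
  {f | realInterpNorm N₀ N₁ θ r f < ∞}

end

/-! By homogeneity of the `K`-functional, `t ^ (-θ) * K(t, f)` is comparable to a constant on each
dyadic scale, so the interpolation quasi-norm is the `ℓ^r` quasi-norm of its values at the points
`2 ^ (k (s₀ - s₁))`, `k ∈ ℤ`. Put `b_j = 2 ^ (j s) ‖f χ_{A_j}‖_q`. At the scale of index `k`, any
decomposition of `f` is at least as expensive as the `k`-th annulus alone, which costs `b_k`;
conversely, splitting `f` between the annuli on either side of the `k`-th one costs at most a
multiple of `sup_j 2 ^ (-ε |k - j|) b_j`. Taking `ℓ^r` quasi-norms in `k` turns both bounds into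
multiples of `‖b‖_{ℓ^r}`. -/

noncomputable section

section NormEquiv

variable {G : Type*} {N M L : G → ℝ≥0∞}

/-- Equivalence of two quasi-norms with values in `[0, ∞]`, the value `∞` marking the elements
outside the space. -/
def NormEquiv (N M : G → ℝ≥0∞) : Prop :=
  ∃ c C : ℝ≥0, 0 < c ∧ 0 < C ∧ ∀ f, (c : ℝ≥0∞) * N f ≤ M f ∧ M f ≤ (C : ℝ≥0∞) * N f

lemma NormEquiv.of_le_mul {C D : ℝ≥0∞} (hC : C ≠ ∞) (hD : D ≠ ∞)
    (hNM : ∀ f, N f ≤ C * M f) (hMN : ∀ f, M f ≤ D * N f) : NormEquiv N M := by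
  lift C to ℝ≥0 using hC
  lift D to ℝ≥0 using hD
  refine ⟨(C + 1)⁻¹, D + 1, by positivity, by positivity, fun f => ⟨?_, ?_⟩⟩
  · rw [ENNReal.coe_inv (by positivity), ENNReal.inv_mul_le_iff (by simp) ENNReal.coe_ne_top]
    exact (hNM f).trans (by gcongr; exact le_self_add)
  · exact (hMN f).trans (by gcongr; exact le_self_add)

lemma NormEquiv.trans (hNM : NormEquiv N M) (hML : NormEquiv M L) : NormEquiv N L := by
  obtain ⟨c, C, hc, hC, h⟩ := hNM
  obtain ⟨c', C', hc', hC', h'⟩ := hML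
  refine ⟨c' * c, C' * C, mul_pos hc' hc, mul_pos hC' hC, fun f => ⟨?_, ?_⟩⟩
  · rw [ENNReal.coe_mul, mul_assoc]
    exact (mul_le_mul_right (h f).1 _).trans (h' f).1
  · rw [ENNReal.coe_mul, mul_assoc]
    exact (h' f).2.trans (mul_le_mul_right (h f).2 _)

lemma NormEquiv.lt_top_iff (h : NormEquiv N M) (f : G) : M f < ∞ ↔ N f < ∞ := by
  obtain ⟨c, C, hc, -, hcC⟩ := h
  refine ⟨fun hf => ?_, fun hf => (hcC f).2.trans_lt (ENNReal.mul_lt_top ENNReal.coe_lt_top hf)⟩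
  exact ENNReal.lt_top_of_mul_ne_top_right ((hcC f).1.trans_lt hf).ne (by simpa using hc.ne')

end NormEquiv

section LrNorm

variable {ι κ : Type*} {r : ℝ≥0∞}

/-- The `ℓ^r` quasi-norm of a family of extended nonnegative numbers, a supremum for `r = ∞`. -/
def lrNorm (r : ℝ≥0∞) (x : ι → ℝ≥0∞) : ℝ≥0∞ :=
  if r = ∞ then ⨆ i, x i else (∑' i, x i ^ r.toReal) ^ (1 / r.toReal)

lemma lrNorm_mono (r : ℝ≥0∞) {x y : ι → ℝ≥0∞} (h : ∀ i, x i ≤ y i) :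
    lrNorm r x ≤ lrNorm r y := by
  unfold lrNorm
  split_ifs
  · exact iSup_mono h
  · gcongr with i
    exact h i

lemma lrNorm_comp_equiv (r : ℝ≥0∞) (x : ι → ℝ≥0∞) (e : κ ≃ ι) :
    lrNorm r (fun i => x (e i)) = lrNorm r x := by
  unfold lrNorm
  split_ifs
  · exact e.iSup_comp
  · rw [e.tsum_eq fun i => x i ^ r.toReal]

lemma lrNorm_const_mul (hr : 0 < r) (c : ℝ≥0∞) (x : ι → ℝ≥0∞) :
    lrNorm r (fun i => c * x i) = c * lrNorm r x := by
  unfold lrNorm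
  split_ifs with h
  · exact (ENNReal.mul_iSup ..).symm
  · have hp : 0 < r.toReal := ENNReal.toReal_pos hr.ne' h
    simp_rw [ENNReal.mul_rpow_of_nonneg _ _ hp.le]
    rw [ENNReal.tsum_mul_left, ENNReal.mul_rpow_of_nonneg _ _ (by positivity), ← ENNReal.rpow_mul,
      mul_one_div_cancel hp.ne', ENNReal.rpow_one]

lemma le_lrNorm (hr : 0 < r) (x : ι → ℝ≥0∞) (i : ι) : x i ≤ lrNorm r x := by
  unfold lrNorm
  split_ifs with h
  · exact le_iSup x i
  · have hp : 0 < r.toReal := ENNReal.toReal_pos hr.ne' h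
    rw [one_div, ENNReal.le_rpow_inv_iff hp]
    exact ENNReal.le_tsum (f := fun i => x i ^ r.toReal) i

end LrNorm

section ExpWeight

lemma two_rpow_add (x y : ℝ) : (2 : ℝ≥0∞) ^ (x + y) = 2 ^ x * 2 ^ y :=
  ENNReal.rpow_add _ _ two_ne_zero ENNReal.ofNat_ne_top

lemma two_rpow_ne_top (x : ℝ) : (2 : ℝ≥0∞) ^ x ≠ ∞ := by
  simp [ENNReal.rpow_eq_top_iff]

lemma ofReal_two_rpow (x : ℝ) : ENNReal.ofReal ((2 : ℝ) ^ x) = 2 ^ x := by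
  rw [← ENNReal.ofReal_rpow_of_pos two_pos, ENNReal.ofReal_ofNat]

/-- The weight `2 ^ (-ε |j|)` on the integers. -/
def expWeight (ε : ℝ) (j : ℤ) : ℝ≥0∞ := 2 ^ (-(ε * |(j : ℝ)|))

lemma expWeight_rpow (ε p : ℝ) (j : ℤ) : expWeight ε j ^ p = expWeight (ε * p) j := by
  rw [expWeight, expWeight, ← ENNReal.rpow_mul]
  congr 1
  ring

lemma expWeight_add (ε δ : ℝ) (j : ℤ) :
    expWeight (ε + δ) j = expWeight ε j * expWeight δ j := by
  rw [expWeight, expWeight, expWeight, ← two_rpow_add]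
  congr 1
  ring

lemma expWeight_anti {ε δ : ℝ} (h : ε ≤ δ) (j : ℤ) : expWeight δ j ≤ expWeight ε j :=
  ENNReal.rpow_le_rpow_of_exponent_le one_le_two
    (neg_le_neg (mul_le_mul_of_nonneg_right h (abs_nonneg _)))

lemma expWeight_le_one {ε : ℝ} (hε : 0 ≤ ε) (j : ℤ) : expWeight ε j ≤ 1 :=
  (expWeight_anti hε j).trans_eq (by simp [expWeight])

lemma tsum_expWeight_ne_top {ε : ℝ} (hε : 0 < ε) : ∑' j, expWeight ε j ≠ ∞ := by
  simp_rw [expWeight, ← ofReal_two_rpow]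
  apply Summable.tsum_ofReal_ne_top
  have hgeom : Summable fun n : ℕ => ((2 : ℝ) ^ (-ε)) ^ n :=
    summable_geometric_of_lt_one (by positivity)
      (Real.rpow_lt_one_of_one_lt_of_neg one_lt_two (neg_neg_of_pos hε))
  have hpow (n : ℕ) : (2 : ℝ) ^ (-(ε * (n : ℝ))) = ((2 : ℝ) ^ (-ε)) ^ n := by
    rw [← Real.rpow_mul_natCast two_pos.le, neg_mul]
  apply Summable.of_nat_of_neg <;> simpa [hpow] using hgeom

lemma lrNorm_expWeight_ne_top {ε : ℝ} (hε : 0 < ε) {r : ℝ≥0∞} (hr : 0 < r) :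
    lrNorm r (expWeight ε) ≠ ∞ := by
  unfold lrNorm
  split_ifs with h
  · exact ne_top_of_le_ne_top ENNReal.one_ne_top (iSup_le (expWeight_le_one hε.le))
  · have hp : 0 < r.toReal := ENNReal.toReal_pos hr.ne' h
    simp_rw [expWeight_rpow]
    exact ENNReal.rpow_ne_top_of_nonneg (by positivity) (tsum_expWeight_ne_top (by positivity))

lemma lrNorm_expWeight_mul_le_iSup {r : ℝ≥0∞} (hr : 0 < r) (ε : ℝ) (b : ℤ → ℝ≥0∞) (k : ℤ) :
    lrNorm r (fun j => expWeight (ε + ε) (k - j) * b j) ≤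
      lrNorm r (expWeight ε) * ⨆ j, expWeight ε (k - j) * b j := by
  rw [← lrNorm_comp_equiv r (expWeight ε) (Equiv.subLeft k), mul_comm, ← lrNorm_const_mul hr]
  refine lrNorm_mono r fun j => ?_
  rw [expWeight_add, mul_assoc, mul_comm]
  exact mul_le_mul_left (le_iSup (fun j => expWeight ε (k - j) * b j) j) _

lemma lrNorm_iSup_expWeight_mul_le {r : ℝ≥0∞} (hr : 0 < r) (ε : ℝ) (b : ℤ → ℝ≥0∞) :
    lrNorm r (fun k => ⨆ j, expWeight ε (k - j) * b j) ≤
      lrNorm r (expWeight ε) * lrNorm r b := by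
  unfold lrNorm
  split_ifs with h
  · exact iSup_le fun k => iSup_le fun j =>
      mul_le_mul' (le_iSup (expWeight ε) (k - j)) (le_iSup b j)
  have hp : 0 < r.toReal := ENNReal.toReal_pos hr.ne' h
  rw [← ENNReal.mul_rpow_of_nonneg _ _ (by positivity)]
  gcongr
  calc ∑' k, (⨆ j, expWeight ε (k - j) * b j) ^ r.toReal
      ≤ ∑' k, ∑' j, (expWeight ε (k - j) * b j) ^ r.toReal := by
        gcongr with k
        rw [← ENNReal.le_rpow_inv_iff hp]
        refine iSup_le fun j => ?_
        rw [ENNReal.le_rpow_inv_iff hp]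
        exact ENNReal.le_tsum (f := fun j => (expWeight ε (k - j) * b j) ^ r.toReal) j
    _ = ∑' j, (∑' k, expWeight ε (k - j) ^ r.toReal) * b j ^ r.toReal := by
        rw [ENNReal.tsum_comm]
        simp_rw [ENNReal.mul_rpow_of_nonneg _ _ hp.le, ENNReal.tsum_mul_right]
    _ = (∑' k, expWeight ε k ^ r.toReal) * ∑' j, b j ^ r.toReal := by
        rw [← ENNReal.tsum_mul_left]
        congr! 3 with j
        exact (Equiv.subRight j).tsum_eq fun k => expWeight ε k ^ r.toReal

end ExpWeight

section MulHaarNorm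

variable {r : ℝ≥0∞}

/-- The `L^r(dt/t)` quasi-norm on `(0, ∞)`. For `r = ∞` it is the supremum and not the essential
supremum, as in the definition of the real interpolation spaces. -/
def mulHaarNorm (r : ℝ≥0∞) (φ : ℝ → ℝ≥0∞) : ℝ≥0∞ :=
  if r = ∞ then ⨆ (t : ℝ) (_ : 0 < t), φ t
  else (∫⁻ t in Set.Ioi (0 : ℝ), φ t ^ r.toReal / ENNReal.ofReal t) ^ (1 / r.toReal)

lemma mulHaarNorm_mono (r : ℝ≥0∞) {φ ψ : ℝ → ℝ≥0∞} (h : ∀ t, 0 < t → φ t ≤ ψ t) :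
    mulHaarNorm r φ ≤ mulHaarNorm r ψ := by
  unfold mulHaarNorm
  split_ifs
  · exact iSup₂_mono h
  · gcongr ?_ ^ _
    refine setLIntegral_mono' measurableSet_Ioi fun t ht => ?_
    gcongr
    exact h t ht

lemma mulHaarNorm_const_mul (hr : 0 < r) {c : ℝ≥0∞} (hc : c ≠ ∞) (φ : ℝ → ℝ≥0∞) :
    mulHaarNorm r (fun t => c * φ t) = c * mulHaarNorm r φ := by
  unfold mulHaarNorm
  split_ifs with h
  · simp_rw [ENNReal.mul_iSup]
  · have hp : 0 < r.toReal := ENNReal.toReal_pos hr.ne' h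
    simp_rw [ENNReal.mul_rpow_of_nonneg _ _ hp.le, mul_div_assoc]
    rw [lintegral_const_mul' _ _ (ENNReal.rpow_ne_top_of_nonneg hp.le hc),
      ENNReal.mul_rpow_of_nonneg _ _ (by positivity), ← ENNReal.rpow_mul,
      mul_one_div_cancel hp.ne', ENNReal.rpow_one]

lemma lintegral_comp_floor (x : ℤ → ℝ≥0∞) : ∫⁻ u : ℝ, x ⌊u⌋ = ∑' k, x k := by
  rw [← lintegral_map (μ := volume) (measurable_of_countable x) Int.measurable_floor,
    lintegral_countable']
  congr! with k
  rw [Measure.map_apply Int.measurable_floor (measurableSet_singleton k),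
    Int.preimage_floor_singleton, Real.volume_Ico]
  simp

lemma setLIntegral_Ioi_div_eq_lintegral_comp_two_rpow {d : ℝ} (hd : d ≠ 0) (φ : ℝ → ℝ≥0∞) :
    ∫⁻ t in Set.Ioi (0 : ℝ), φ t / ENNReal.ofReal t =
      ENNReal.ofReal (|d| * Real.log 2) * ∫⁻ u : ℝ, φ (2 ^ (u * d)) := by
  have hlog : 0 < Real.log 2 := Real.log_pos one_lt_two
  have hderiv (u : ℝ) :
      HasDerivAt (fun u : ℝ => (2 : ℝ) ^ (u * d)) (Real.log 2 * d * 2 ^ (u * d)) u := by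
    simpa using ((hasDerivAt_id u).mul_const d).const_rpow two_pos
  have hinj : Function.Injective fun u : ℝ => (2 : ℝ) ^ (u * d) := fun u v huv =>
    mul_right_cancel₀ hd ((Real.strictMono_rpow_of_base_gt_one one_lt_two).injective huv)
  have himage : (fun u : ℝ => (2 : ℝ) ^ (u * d)) '' Set.univ = Set.Ioi 0 := by
    ext t
    simp only [Set.image_univ, Set.mem_range, Set.mem_Ioi]
    refine ⟨fun ⟨u, hu⟩ => hu ▸ by positivity, fun ht => ⟨Real.logb 2 t / d, ?_⟩⟩
    rw [div_mul_cancel₀ _ hd, Real.rpow_logb two_pos (by norm_num) ht]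
  rw [← himage, lintegral_image_eq_lintegral_abs_deriv_mul MeasurableSet.univ
    (fun u _ => (hderiv u).hasDerivWithinAt) hinj.injOn, setLIntegral_univ,
    ← lintegral_const_mul' _ _ ENNReal.ofReal_ne_top]
  refine lintegral_congr fun u => ?_
  have hpos : (0 : ℝ) < 2 ^ (u * d) := by positivity
  rw [abs_mul, abs_mul, abs_of_pos hlog, abs_of_pos hpos, ENNReal.ofReal_mul (by positivity),
    mul_comm (Real.log 2), mul_assoc,
    ENNReal.mul_div_cancel (by simpa using hpos) ENNReal.ofReal_ne_top]

lemma mulHaarNorm_comp_floor_logb {d : ℝ} (hd : d ≠ 0) (x : ℤ → ℝ≥0∞) :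
    mulHaarNorm r (fun t => x ⌊Real.logb 2 t / d⌋) =
      ENNReal.ofReal (|d| * Real.log 2) ^ (1 / r.toReal) * lrNorm r x := by
  have hlogb (u : ℝ) : Real.logb 2 (2 ^ (u * d)) / d = u := by
    rw [Real.logb_rpow two_pos (by norm_num), mul_div_cancel_right₀ _ hd]
  unfold mulHaarNorm lrNorm
  split_ifs with h
  · rw [h, ENNReal.toReal_top, div_zero, ENNReal.rpow_zero, one_mul]
    refine le_antisymm (iSup₂_le fun t _ => le_iSup x _) (iSup_le fun k => ?_)
    refine le_iSup₂_of_le ((2 : ℝ) ^ ((k : ℝ) * d)) (by positivity) ?_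
    simp only [hlogb, Int.floor_intCast, le_refl]
  · rw [setLIntegral_Ioi_div_eq_lintegral_comp_two_rpow hd
      fun t => x ⌊Real.logb 2 t / d⌋ ^ r.toReal]
    simp_rw [hlogb]
    rw [lintegral_comp_floor fun k => x k ^ r.toReal,
      ENNReal.mul_rpow_of_nonneg _ _ (by positivity)]

end MulHaarNorm

section KFunctional

variable {G : Type*} [AddCommGroup G] {N₀ N₁ : G → ℝ≥0∞} {θ : ℝ} {f : G}

lemma kFunctional_add_le {t : ℝ} (ht : 0 < t) (f₀ f₁ : G) :
    kFunctional N₀ N₁ t (f₀ + f₁) ≤ N₀ f₀ + ENNReal.ofReal t * N₁ f₁ := by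
  rcases eq_or_ne (N₀ f₀ + ENNReal.ofReal t * N₁ f₁) ∞ with htop | htop
  · exact htop ▸ le_top
  have h₀ : N₀ f₀ < ∞ := (ENNReal.add_ne_top.1 htop).1.lt_top
  have h₁ : N₁ f₁ < ∞ :=
    ENNReal.lt_top_of_mul_ne_top_right (ENNReal.add_ne_top.1 htop).2 (by simpa using ht)
  exact iInf₂_le_of_le f₀ f₁ (iInf_le_of_le rfl (iInf₂_le h₀ h₁))

lemma le_mul_kFunctional {t : ℝ} {c C : ℝ≥0∞} (hC : C ≠ ∞)
    (h : ∀ f₀ f₁, f = f₀ + f₁ → c ≤ C * (N₀ f₀ + ENNReal.ofReal t * N₁ f₁)) :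
    c ≤ C * kFunctional N₀ N₁ t f := by
  rcases eq_or_ne C 0 with rfl | hC₀
  · simpa using h f 0 (add_zero f).symm
  rw [← ENNReal.inv_mul_le_iff hC₀ hC]
  refine le_iInf₂ fun f₀ f₁ => le_iInf fun hf => le_iInf₂ fun _ _ => ?_
  rw [ENNReal.inv_mul_le_iff hC₀ hC]
  exact h f₀ f₁ hf

lemma kFunctional_le_mul_of_le_mul {t u c : ℝ} (ht : 0 < t) (hc : 1 ≤ c) (htu : t ≤ c * u) :
    kFunctional N₀ N₁ t f ≤ ENNReal.ofReal c * kFunctional N₀ N₁ u f := by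
  refine le_mul_kFunctional ENNReal.ofReal_ne_top ?_
  rintro f₀ f₁ rfl
  calc kFunctional N₀ N₁ t (f₀ + f₁) ≤ N₀ f₀ + ENNReal.ofReal t * N₁ f₁ := kFunctional_add_le ht _ _
    _ ≤ ENNReal.ofReal c * N₀ f₀ + ENNReal.ofReal (c * u) * N₁ f₁ := by
        gcongr
        exact le_mul_of_one_le_left zero_le (by simpa using hc)
    _ = ENNReal.ofReal c * (N₀ f₀ + ENNReal.ofReal u * N₁ f₁) := by
        rw [mul_add, ENNReal.ofReal_mul (by positivity), mul_assoc]

/-- The function `t ^ (-θ) K(t, f)` of `t`, whose `L^r(dt/t)` quasi-norm is the quasi-norm of the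
real interpolation space. -/
def scaledK (N₀ N₁ : G → ℝ≥0∞) (θ : ℝ) (f : G) (t : ℝ) : ℝ≥0∞ :=
  ENNReal.ofReal t ^ (-θ) * kFunctional N₀ N₁ t f

lemma realInterpNorm_eq_mulHaarNorm (N₀ N₁ : G → ℝ≥0∞) (θ : ℝ) (r : ℝ≥0∞) (f : G) :
    realInterpNorm N₀ N₁ θ r f = mulHaarNorm r (scaledK N₀ N₁ θ f) := rfl

lemma scaledK_le_mul (hθ : 0 ≤ θ) {t u c : ℝ} (ht : 0 < t) (hu : 0 < u) (hc : 1 ≤ c)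
    (htu : t ≤ c * u) (hut : u ≤ c * t) :
    scaledK N₀ N₁ θ f t ≤ ENNReal.ofReal (c ^ θ * c) * scaledK N₀ N₁ θ f u := by
  have hc₀ : 0 < c := by positivity
  have hpow : t ^ (-θ) ≤ c ^ θ * u ^ (-θ) := by
    calc t ^ (-θ) = c ^ θ * (c * t) ^ (-θ) := by
          rw [Real.mul_rpow hc₀.le ht.le, ← mul_assoc, ← Real.rpow_add hc₀, add_neg_cancel,
            Real.rpow_zero, one_mul]
      _ ≤ c ^ θ * u ^ (-θ) :=
          mul_le_mul_of_nonneg_left (Real.rpow_le_rpow_of_nonpos hu hut (neg_nonpos.2 hθ))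
            (by positivity)
  calc scaledK N₀ N₁ θ f t
      ≤ ENNReal.ofReal (c ^ θ * u ^ (-θ)) * (ENNReal.ofReal c * kFunctional N₀ N₁ u f) := by
        rw [scaledK, ENNReal.ofReal_rpow_of_pos ht]
        gcongr
        exact kFunctional_le_mul_of_le_mul ht hc htu
    _ = ENNReal.ofReal (c ^ θ * c) * scaledK N₀ N₁ θ f u := by
        rw [scaledK, ENNReal.ofReal_rpow_of_pos hu, ENNReal.ofReal_mul (by positivity),
          ENNReal.ofReal_mul (by positivity)]
        ring

lemma le_two_rpow_abs_mul_two_rpow {d t : ℝ} (hd : d ≠ 0) (ht : 0 < t) :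
    t ≤ 2 ^ |d| * 2 ^ (⌊Real.logb 2 t / d⌋ * d) ∧ 2 ^ (⌊Real.logb 2 t / d⌋ * d) ≤ 2 ^ |d| * t := by
  set u := Real.logb 2 t / d with hu
  have htu : t = 2 ^ (u * d) := by
    rw [hu, div_mul_cancel₀ _ hd, Real.rpow_logb two_pos (by norm_num) ht]
  have hdist : |u * d - ⌊u⌋ * d| ≤ |d| := by
    rw [← sub_mul, abs_mul, Int.self_sub_floor, abs_of_nonneg (Int.fract_nonneg u)]
    exact mul_le_of_le_one_left (abs_nonneg d) (Int.fract_lt_one u).le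
  obtain ⟨hlow, hup⟩ := abs_le.1 hdist
  rw [htu, ← Real.rpow_add two_pos, ← Real.rpow_add two_pos]
  exact ⟨Real.rpow_le_rpow_of_exponent_le one_le_two (by linarith),
    Real.rpow_le_rpow_of_exponent_le one_le_two (by linarith)⟩

lemma normEquiv_lrNorm_scaledK_realInterpNorm (N₀ N₁ : G → ℝ≥0∞) (hθ : 0 ≤ θ) {d : ℝ} (hd : d ≠ 0)
    {r : ℝ≥0∞} (hr : 0 < r) :
    NormEquiv (fun f => lrNorm r fun k : ℤ => scaledK N₀ N₁ θ f (2 ^ (k * d)))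
      (realInterpNorm N₀ N₁ θ r) := by
  have hscale : (1 : ℝ) ≤ 2 ^ |d| := Real.one_le_rpow one_le_two (abs_nonneg d)
  set C := ENNReal.ofReal (((2 : ℝ) ^ |d|) ^ θ * 2 ^ |d|)
  have hC : C ≠ ∞ := ENNReal.ofReal_ne_top
  have hlen : 0 < |d| * Real.log 2 := mul_pos (abs_pos.2 hd) (Real.log_pos one_lt_two)
  set c := ENNReal.ofReal (|d| * Real.log 2) ^ (1 / r.toReal)
  have hc : c ≠ ∞ := ENNReal.rpow_ne_top_of_nonneg (by positivity) ENNReal.ofReal_ne_top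
  have hc₀ : c ≠ 0 := (ENNReal.rpow_pos (ENNReal.ofReal_pos.2 hlen) ENNReal.ofReal_ne_top).ne'
  refine .of_le_mul (ENNReal.mul_ne_top (ENNReal.inv_ne_top.2 hc₀) hC) (ENNReal.mul_ne_top hC hc)
    (fun f => ?_) fun f => ?_
  · rw [mul_assoc, ← ENNReal.mul_le_iff_le_inv hc₀ hc, ← mulHaarNorm_comp_floor_logb hd,
      realInterpNorm_eq_mulHaarNorm, ← mulHaarNorm_const_mul hr hC]
    refine mulHaarNorm_mono r fun t ht => ?_
    obtain ⟨hup, hlow⟩ := le_two_rpow_abs_mul_two_rpow hd ht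
    exact scaledK_le_mul hθ (by positivity) ht hscale hlow hup
  · rw [mul_assoc, ← mulHaarNorm_comp_floor_logb hd, realInterpNorm_eq_mulHaarNorm,
      ← mulHaarNorm_const_mul hr hC]
    refine mulHaarNorm_mono r fun t ht => ?_
    obtain ⟨hup, hlow⟩ := le_two_rpow_abs_mul_two_rpow hd ht
    exact scaledK_le_mul hθ ht (by positivity) hscale hup hlow

end KFunctional

section BlockNorm

variable {G : Type*} {a : ℤ → G → ℝ≥0∞} {θ s s₀ s₁ : ℝ} {r r₀ r₁ : ℝ≥0∞}

/-- The weighted sequence `2 ^ (j s) a_j(f)` of block sizes. -/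
def weightedBlocks (a : ℤ → G → ℝ≥0∞) (s : ℝ) (f : G) (j : ℤ) : ℝ≥0∞ :=
  2 ^ (j * s) * a j f

/-- The quasi-norm whose value is the `ℓ^r` quasi-norm of the weighted block sizes; for the annuli
of `ℝⁿ` it is the Herz quasi-norm. -/
def blockNorm (a : ℤ → G → ℝ≥0∞) (s : ℝ) (r : ℝ≥0∞) (f : G) : ℝ≥0∞ :=
  lrNorm r (weightedBlocks a s f)

lemma two_rpow_mul_blockNorm_le (hr : 0 < r) {x δ s s' : ℝ} {J : Set ℤ} {k : ℤ} {f g : G}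
    (hg : ∀ j, a j g ≤ J.indicator (a · f) j)
    (hx : ∀ j ∈ J, x + j * s' = -(δ * |((k - j : ℤ) : ℝ)|) + j * s) :
    2 ^ x * blockNorm a s' r g ≤
      lrNorm r fun j => expWeight δ (k - j) * weightedBlocks a s f j := by
  rw [blockNorm, ← lrNorm_const_mul hr]
  refine lrNorm_mono r fun j => ?_
  by_cases hj : j ∈ J
  · have hgj : a j g ≤ a j f := (hg j).trans_eq (Set.indicator_of_mem hj _)
    rw [weightedBlocks, weightedBlocks, expWeight, ← mul_assoc, ← mul_assoc, ← two_rpow_add,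
      ← two_rpow_add, hx j hj]
    gcongr
  · have hgj : a j g = 0 := le_antisymm ((hg j).trans_eq (Set.indicator_of_notMem hj _)) zero_le
    simp [weightedBlocks, hgj]

variable [AddCommGroup G]

lemma weightedBlocks_le_mul_scaledK (hr₀ : 0 < r₀) (hr₁ : 0 < r₁)
    (hs : s = (1 - θ) * s₀ + θ * s₁) {κ : ℝ≥0∞} (hκ : κ ≠ ∞) {k : ℤ}
    (hadd : ∀ f g, a k (f + g) ≤ κ * (a k f + a k g)) (f : G) :
    weightedBlocks a s f k ≤
      κ * scaledK (blockNorm a s₀ r₀) (blockNorm a s₁ r₁) θ f (2 ^ (k * (s₀ - s₁))) := by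
  rw [scaledK, ← mul_assoc, ofReal_two_rpow, ← ENNReal.rpow_mul]
  refine le_mul_kFunctional (ENNReal.mul_ne_top hκ (two_rpow_ne_top _)) ?_
  rintro f₀ f₁ rfl
  calc weightedBlocks a s (f₀ + f₁) k ≤ 2 ^ (k * s) * (κ * (a k f₀ + a k f₁)) := by
        rw [weightedBlocks]
        gcongr
        exact hadd f₀ f₁
    _ = κ * 2 ^ (k * (s₀ - s₁) * -θ) *
          (weightedBlocks a s₀ f₀ k + 2 ^ (k * (s₀ - s₁)) * weightedBlocks a s₁ f₁ k) := by
        rw [mul_left_comm, mul_assoc κ]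
        congr 1
        rw [mul_add, mul_add]
        simp only [weightedBlocks, ← mul_assoc, ← two_rpow_add]
        rw [hs]
        ring_nf
    _ ≤ κ * 2 ^ (k * (s₀ - s₁) * -θ) *
          (blockNorm a s₀ r₀ f₀ + ENNReal.ofReal (2 ^ (k * (s₀ - s₁))) * blockNorm a s₁ r₁ f₁) := by
        rw [ofReal_two_rpow]
        gcongr
        exacts [le_lrNorm hr₀ _ k, le_lrNorm hr₁ _ k]

/-- The functionals `a j` measure the sizes of the blocks of a decomposition indexed by `ℤ`: they
satisfy a common quasi-triangle inequality, and every element can be split along any partition of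
the blocks into two families. For Herz spaces, `a j f` is the `L^q` quasi-norm of `f` on the `j`-th
annulus. -/
structure IsBlockFamily (a : ℤ → G → ℝ≥0∞) : Prop where
  exists_add_le :
    ∃ κ : ℝ≥0∞, κ ≠ ∞ ∧ ∀ j f g, a j (f + g) ≤ κ * (a j f + a j g)
  exists_split : ∀ (f : G) (J : Set ℤ), ∃ g h, f = g + h ∧
    (∀ j, a j g ≤ J.indicator (a · f) j) ∧ ∀ j, a j h ≤ Jᶜ.indicator (a · f) j

lemma IsBlockFamily.scaledK_le_add (ha : IsBlockFamily a) (hr₀ : 0 < r₀) (hr₁ : 0 < r₁)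
    (hs : s = (1 - θ) * s₀ + θ * s₁) (f : G) (k : ℤ) :
    scaledK (blockNorm a s₀ r₀) (blockNorm a s₁ r₁) θ f (2 ^ (k * (s₀ - s₁))) ≤
      lrNorm r₀ (fun j => expWeight (θ * |s₀ - s₁|) (k - j) * weightedBlocks a s f j) +
        lrNorm r₁ (fun j => expWeight ((1 - θ) * |s₀ - s₁|) (k - j) * weightedBlocks a s f j) := by
  obtain ⟨g, h, rfl, hg, hh⟩ := ha.exists_split f {j | 0 ≤ (s₀ - s₁) * (k - j)}
  have hcost := kFunctional_add_le (N₀ := blockNorm a s₀ r₀) (N₁ := blockNorm a s₁ r₁)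
    (t := 2 ^ (k * (s₀ - s₁))) (by positivity) g h
  rw [ofReal_two_rpow] at hcost
  rw [scaledK, ofReal_two_rpow, ← ENNReal.rpow_mul]
  refine (mul_le_mul_right hcost _).trans ?_
  rw [mul_add, ← mul_assoc, ← two_rpow_add]
  refine add_le_add (two_rpow_mul_blockNorm_le hr₀ hg fun j hj => ?_)
    (two_rpow_mul_blockNorm_le hr₁ hh fun j hj => ?_)
  · rw [mul_assoc θ, ← abs_mul, Int.cast_sub, abs_of_nonneg hj, hs]
    ring
  · have hneg : (s₀ - s₁) * (k - j) < 0 := not_le.1 hj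
    rw [mul_assoc (1 - θ), ← abs_mul, Int.cast_sub, abs_of_neg hneg, hs]
    ring

lemma IsBlockFamily.exists_scaledK_le_iSup (ha : IsBlockFamily a) (hr₀ : 0 < r₀) (hr₁ : 0 < r₁)
    (hθ₀ : 0 < θ) (hθ₁ : θ < 1) (hne : s₀ ≠ s₁) (hs : s = (1 - θ) * s₀ + θ * s₁) :
    ∃ ε : ℝ, 0 < ε ∧ ∃ C : ℝ≥0∞, C ≠ ∞ ∧ ∀ (f : G) (k : ℤ),
      scaledK (blockNorm a s₀ r₀) (blockNorm a s₁ r₁) θ f (2 ^ (k * (s₀ - s₁))) ≤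
        C * ⨆ j, expWeight ε (k - j) * weightedBlocks a s f j := by
  have hd : 0 < |s₀ - s₁| := abs_pos.2 (sub_ne_zero.2 hne)
  obtain ⟨ε, hε, hεθ, hεθ'⟩ : ∃ ε, 0 < ε ∧ ε + ε ≤ θ * |s₀ - s₁| ∧ ε + ε ≤ (1 - θ) * |s₀ - s₁| := by
    refine ⟨min (θ * |s₀ - s₁|) ((1 - θ) * |s₀ - s₁|) / 2,
      half_pos (lt_min (mul_pos hθ₀ hd) (mul_pos (sub_pos.2 hθ₁) hd)), ?_⟩
    rw [add_halves]
    exact ⟨min_le_left _ _, min_le_right _ _⟩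
  refine ⟨ε, hε, lrNorm r₀ (expWeight ε) + lrNorm r₁ (expWeight ε), ENNReal.add_ne_top.2
    ⟨lrNorm_expWeight_ne_top hε hr₀, lrNorm_expWeight_ne_top hε hr₁⟩, fun f k => ?_⟩
  refine (ha.scaledK_le_add hr₀ hr₁ hs f k).trans ?_
  rw [add_mul]
  gcongr
  · exact (lrNorm_mono _ fun j => mul_le_mul_left (expWeight_anti hεθ _) _).trans
      (lrNorm_expWeight_mul_le_iSup hr₀ ε _ k)
  · exact (lrNorm_mono _ fun j => mul_le_mul_left (expWeight_anti hεθ' _) _).trans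
      (lrNorm_expWeight_mul_le_iSup hr₁ ε _ k)

lemma IsBlockFamily.normEquiv_blockNorm_lrNorm_scaledK (ha : IsBlockFamily a) (hr : 0 < r)
    (hr₀ : 0 < r₀) (hr₁ : 0 < r₁) (hθ₀ : 0 < θ) (hθ₁ : θ < 1) (hne : s₀ ≠ s₁)
    (hs : s = (1 - θ) * s₀ + θ * s₁) :
    NormEquiv (blockNorm a s r) fun f => lrNorm r fun k : ℤ =>
      scaledK (blockNorm a s₀ r₀) (blockNorm a s₁ r₁) θ f (2 ^ (k * (s₀ - s₁))) := by
  obtain ⟨κ, hκ, hadd⟩ := ha.exists_add_le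
  obtain ⟨ε, hε, C, hC, hle⟩ := ha.exists_scaledK_le_iSup hr₀ hr₁ hθ₀ hθ₁ hne hs
  refine .of_le_mul hκ (ENNReal.mul_ne_top hC (lrNorm_expWeight_ne_top hε hr))
    (fun f => ?_) fun f => ?_
  · rw [← lrNorm_const_mul hr]
    exact lrNorm_mono r fun k => weightedBlocks_le_mul_scaledK hr₀ hr₁ hs hκ (hadd k) f
  · refine (lrNorm_mono r (hle f)).trans ?_
    rw [lrNorm_const_mul hr, mul_assoc]
    exact mul_le_mul_right (lrNorm_iSup_expWeight_mul_le hr ε _) C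

theorem theorem2p7_general (ha : IsBlockFamily a) (hθ₀ : 0 < θ) (hθ₁ : θ < 1) (hr : 0 < r)
    (hr₀ : 0 < r₀) (hr₁ : 0 < r₁) (hne : s₀ ≠ s₁) (hs : s = (1 - θ) * s₀ + θ * s₁) :
    realInterpSpace (blockNorm a s₀ r₀) (blockNorm a s₁ r₁) θ r = {f | blockNorm a s r f < ∞} ∧
      NormEquiv (blockNorm a s r) (realInterpNorm (blockNorm a s₀ r₀) (blockNorm a s₁ r₁) θ r) := by
  have hequiv := (ha.normEquiv_blockNorm_lrNorm_scaledK hr hr₀ hr₁ hθ₀ hθ₁ hne hs).trans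
    (normEquiv_lrNorm_scaledK_realInterpNorm _ _ hθ₀.le (sub_ne_zero.2 hne) hr)
  exact ⟨Set.ext hequiv.lt_top_iff, hequiv⟩

end BlockNorm

section DisjointSets

variable {α E : Type*} [MeasurableSpace α] {μ : Measure α} [NormedAddCommGroup E]

lemma eLpNorm_indicator_coeFn_add_le {A : Set α} (hA : MeasurableSet A) (q : ℝ≥0∞)
    (f g : α →ₘ[μ] E) :
    eLpNorm (A.indicator ⇑(f + g)) q μ ≤
      ENNReal.LpAddConst q * (eLpNorm (A.indicator f) q μ + eLpNorm (A.indicator g) q μ) := by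
  rw [eLpNorm_congr_ae (AEEqFun.coeFn_add f g).indicator, Set.indicator_add']
  exact eLpNorm_add_le' (f.aestronglyMeasurable.indicator hA)
    (g.aestronglyMeasurable.indicator hA) q

lemma exists_add_eq_and_ae_eq_indicator (f : α →ₘ[μ] E) {B : Set α} (hB : MeasurableSet B) :
    ∃ g h : α →ₘ[μ] E, f = g + h ∧ g =ᵐ[μ] B.indicator f ∧ h =ᵐ[μ] Bᶜ.indicator f := by
  have hg := AEEqFun.coeFn_mk (μ := μ) _ (f.aestronglyMeasurable.indicator hB)
  have hh := AEEqFun.coeFn_mk (μ := μ) _ (f.aestronglyMeasurable.indicator hB.compl)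
  refine ⟨_, _, AEEqFun.ext ?_, hg, hh⟩
  filter_upwards [hg, hh, AEEqFun.coeFn_add (AEEqFun.mk _ (f.aestronglyMeasurable.indicator hB))
    (AEEqFun.mk _ (f.aestronglyMeasurable.indicator hB.compl))] with x hxg hxh hx
  rw [hx, Pi.add_apply, hxg, hxh, Set.indicator_self_add_compl_apply]

lemma isBlockFamily_eLpNorm_indicator {A : ℤ → Set α} (hA : ∀ j, MeasurableSet (A j))
    (hdisj : Pairwise (Function.onFun Disjoint A)) (q : ℝ≥0∞) :
    IsBlockFamily fun j (f : α →ₘ[μ] E) => eLpNorm ((A j).indicator f) q μ where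
  exists_add_le := ⟨ENNReal.LpAddConst q, (ENNReal.LpAddConst_lt_top q).ne,
    fun j f g => eLpNorm_indicator_coeFn_add_le (hA j) q f g⟩
  exists_split f J := by
    obtain ⟨g, h, hf, hg, hh⟩ := exists_add_eq_and_ae_eq_indicator f
      (MeasurableSet.biUnion J.to_countable fun j _ => hA j)
    have hsub {j} (hj : j ∈ J) : A j ⊆ ⋃ i ∈ J, A i := Set.subset_biUnion_of_mem hj
    have hdisjoint {j} (hj : j ∉ J) : Disjoint (A j) (⋃ i ∈ J, A i) :=
      Set.disjoint_iUnion₂_right.2 fun i hi => hdisj fun hji => hj (hji ▸ hi)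
    refine ⟨g, h, hf, fun j => ?_, fun j => ?_⟩
    · rw [eLpNorm_congr_ae hg.indicator, Set.indicator_indicator]
      by_cases hj : j ∈ J
      · simp [hj, Set.inter_eq_left.2 (hsub hj)]
      · simp [hj, (hdisjoint hj).inter_eq]
    · rw [eLpNorm_congr_ae hh.indicator, Set.indicator_indicator]
      by_cases hj : j ∈ J
      · rw [(Set.disjoint_compl_right_iff_subset.2 (hsub hj)).inter_eq]
        simp
      · rw [Set.inter_eq_left.2 (hdisjoint hj).subset_compl_right,
          Set.indicator_of_mem (Set.mem_compl hj)]

end DisjointSets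

lemma measurableSet_dyadicAnnulus (n : ℕ) (j : ℤ) : MeasurableSet (dyadicAnnulus n j) :=
  (measurableSet_le measurable_const measurable_norm).inter
    (measurableSet_lt measurable_norm measurable_const)

lemma pairwise_disjoint_dyadicAnnulus (n : ℕ) :
    Pairwise (Function.onFun Disjoint (dyadicAnnulus n)) := by
  have hmono : Monotone fun j : ℤ => (2 : ℝ) ^ (j - 1) := fun i j hij =>
    zpow_le_zpow_right₀ one_le_two (by lia)
  intro i j hij
  have hIco := hmono.pairwise_disjoint_on_Ico_succ hij
  simp only [Function.onFun, Order.succ_eq_add_one, add_sub_cancel_right] at hIco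
  exact hIco.preimage norm

lemma herzNorm_eq_blockNorm (n : ℕ) (𝕜 : Type*) [RCLike 𝕜] (s : ℝ) (q r : ℝ≥0∞) :
    herzNorm (n := n) (𝕜 := 𝕜) s q r =
      blockNorm (fun j (f : MeasFun n 𝕜) => eLpNorm ((dyadicAnnulus n j).indicator f) q volume)
        s r := rfl

end

theorem theorem2p7 {𝕜 : Type*} [RCLike 𝕜] (n : ℕ) (hn : 1 ≤ n)
    (θ s s₀ s₁ : ℝ) (hθ₀ : 0 < θ) (hθ₁ : θ < 1)
    (q r r₀ r₁ : ℝ≥0∞) (hq : 0 < q) (hr : 0 < r) (hr₀ : 0 < r₀) (hr₁ : 0 < r₁)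
    (hne : s₀ ≠ s₁) (hs : s = (1 - θ) * s₀ + θ * s₁) :
    realInterpSpace (herzNorm (n := n) (𝕜 := 𝕜) s₀ q r₀) (herzNorm s₁ q r₁) θ r
        = herzSpace n 𝕜 s q r ∧
      ∃ c C : ℝ≥0, 0 < c ∧ 0 < C ∧ ∀ f : MeasFun n 𝕜,
        (c : ℝ≥0∞) * herzNorm s q r f
            ≤ realInterpNorm (herzNorm s₀ q r₀) (herzNorm s₁ q r₁) θ r f ∧
          realInterpNorm (herzNorm s₀ q r₀) (herzNorm s₁ q r₁) θ r f
            ≤ (C : ℝ≥0∞) * herzNorm s q r f := by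
  simp only [herzSpace, herzNorm_eq_blockNorm]
  exact theorem2p7_general (isBlockFamily_eLpNorm_indicator (measurableSet_dyadicAnnulus n)
    (pairwise_disjoint_dyadicAnnulus n) q) hθ₀ hθ₁ hr hr₀ hr₁ hne hs
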